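/- **Completeness of let-rewriting.** Let $\Sigma = CS\cup FS$ be a first-order signature with disjoint sets of constructor symbols ($c$) and function symbols ($f$), and let $\mathcal V$ be a denumerable set of variables. *Let-expressions* ($LExp$) are given by $e ::= X \mid h(e_1,\dots,e_n) \mid let\ X=e_1\ in\ e_2$ with $h\in\Sigma$ of arity $n$; the let binds $X$ in $e_2$ only, and expressions are taken up to renaming of bound variables, with capture-avoiding substitution. *C-terms* ($CTerm$) are built from variables and constructors only. Adding a constant constructor $\bot$ gives $LExp_\bot$ and $CTerm_\bot$ (partial c-terms); $\sqsubseteq$ is the least partial ordering with $\bot\sqsubseteq e$ that is closed under contexts. $CSubst$ ($CSubst_\bot$) is the set of substitutions of finite domain with values in $CTerm$ ($CTerm_\bot$). A *program* $\mathcal P$ is any set of rules $f(p_1,\dots,p_n)\to r$ with $(p_1,\dots,p_n)$ a linear tuple of c-terms and $r\in LExp$ (extra variables in $r$ are allowed). The calculus $CRWL_{let}$ derives statements $e \rightarrowtriangle t$ ($e\in LExp_\bot$, $t\in CTerm_\bot$) by the rules: (B) $e\rightarrowtriangle\bot$; (RR) $X\rightarrowtriangle X$; (DC) from $e_i\rightarrowtriangle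 t_i$ for all $i$ infer $c(\overline e)\rightarrowtriangle c(\overline t)$; (OR) from $e_i\rightarrowtriangle p_i\theta$ for all $i$ and $r\theta\rightarrowtriangle t$ infer $f(\overline e)\rightarrowtriangle t$, where $(f(\overline p)\to r)\in\mathcal P$ and $\theta\in CSubst_\bot$; (Let) from $e_1\rightarrowtriangle t_1$ and $e_2[X/t_1]\rightarrowtriangle t$ infer $let\ X=e_1\ in\ e_2\rightarrowtriangle t$. The calculus $CRWL$ has the rules (B), (RR), (DC), (OR) only, and applies to let-free programs and expressions. *Let-rewriting* $\to^l$ on $LExp$ is the closure under one-hole contexts $\mathcal C$ of: (Fapp) $f(\overline p)\theta\to^l r\theta$ for $(f(\overline p)\to r)\in\mathcal P$ and $\theta\in CSubst$, where the restriction of $\theta$ to the variables not in $\overline p$ introduces no variable that $\mathcal C$ binds at its hole; (LetIn) $h(\dots,e,\dots)\to^l let\ X=e\ in\ h(\dots,X,\dots)$ with $X$ fresh, if $h\in\Sigma$ and $e$ is a let-expression $let\ Y=e'\ in\ e''$ or has a root symbol in $FS$; (Bind) $let\ X=t\ in\ e\to^l e[X/t]$ if $t\in CTerm$; (Elim) $let\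 X=e_1\ in\ e_2\to^l e_2$ if $X\notin FV(e_2)$; (Flat) $let\ X=(let\ Y=e_1\ in\ e_2)\ in\ e_3\to^l let\ Y=e_1\ in\ (let\ X=e_2\ in\ e_3)$ if $Y\notin FV(e_3)$. Write $\to^{l*}$ for its reflexive-transitive closure. The *shell* $|e|$ is defined by $|X|=X$, $|c(e_1,\dots,e_n)|=c(|e_1|,\dots,|e_n|)$, $|f(e_1,\dots,e_n)|=\bot$, and $|let\ X=e_1\ in\ e_2|=|e_2|[X/|e_1|]$. **Theorem.** For every program $\mathcal P$, every $e\in LExp$ and every $t\in CTerm_\bot$: 1. $\mathcal P\vdash_{CRWL_{let}} e\rightarrowtriangle t$ implies $e\to^{l*}e'$ for some $e'\in LExp$ with $t\sqsubseteq|e'|$. 2. If moreover $t\in CTerm$, then $\mathcal P\vdash_{CRWL_{let}} e\rightarrowtriangle t$ implies $e\to^{l*}t$. Furthermore, if neither $\mathcal P$ nor $e$ contains lets, then: 3. $\mathcal P\vdash_{CRWL} e\rightarrowtriangle t$ implies $e\to^{l*}e'$ for some $e'\in LExp$ with $t\sqsubseteq|e'|$. 4. If moreover $t\in CTerm$, then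 $\mathcal P\vdash_{CRWL} e\rightarrowtriangle t$ implies $e\to^{l*}t$. -/

import Mathlib

universe u v

namespace LetRewriting

/-- A first order signature: two disjoint sets `CS` (constructor symbols) and `FS` (defined
function symbols), each symbol with its arity. -/
structure Signature where
  CS : Type u
  FS : Type v
  arityC : CS → ℕ
  arityF : FS → ℕ

/-- The symbols `Σ = CS ∪ FS` (disjoint union). -/
abbrev Signature.Sym (S : Signature.{u, v}) : Type (max u v) := S.CS ⊕ S.FS

/-- The arity of a symbol of `Σ`. -/
abbrev Signature.arity (S : Signature.{u, v}) : S.Sym → ℕ := Sum.elim S.arityC S.arityF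

/-- The denumerable set of variables. -/
abbrev Var : Type := ℕ

/-- The variables visible at a position that lies in the scope of `n` let-binders: the free
variables `Sum.inl x`, and the `n` let-bound ones `Sum.inr i`, where `Sum.inr 0` belongs to the
innermost binder. So let-expressions are represented up to renaming of bound variables. -/
abbrev Scope (n : ℕ) : Type := Var ⊕ Fin n

/-- Partial let-expressions `e ::= X | ⊥ | h(e₁,…,eₘ) | let X = e₁ in e₂` below `n` let-binders.
The variable `X` bound by `letE e₁ e₂` is visible in `e₂` only, as `Sum.inr 0` (lets are not
recursive). The set `LExp_⊥` of the partial let-expressions proper is the case `n = 0`. -/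
inductive Expr (S : Signature.{u, v}) : ℕ → Type (max u v)
  | var {n : ℕ} (X : Scope n) : Expr S n
  | bot {n : ℕ} : Expr S n
  | app {n : ℕ} (h : S.Sym) (args : Fin (S.arity h) → Expr S n) : Expr S n
  | letE {n : ℕ} (e₁ : Expr S n) (e₂ : Expr S (n + 1)) : Expr S n

variable {S : Signature.{u, v}}

namespace Expr

/-! ### Classes of expressions -/

/-- `e` does not contain `⊥`; for `n = 0` this is the set `LExp` of let-expressions. -/
def IsTotal {n : ℕ} : Expr S n → Prop
  | var _ => True
  | bot => False
  | app _ args => ∀ i, (args i).IsTotal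
  | letE e₁ e₂ => e₁.IsTotal ∧ e₂.IsTotal

/-- `e` contains no let; for `n = 0` this is the set `Exp_⊥`, and `Exp` if `e` is also total. -/
def LetFree {n : ℕ} : Expr S n → Prop
  | var _ => True
  | bot => True
  | app _ args => ∀ i, (args i).LetFree
  | letE _ _ => False

/-- `CTerm_⊥`: the partial c-terms, made of variables, `⊥` and constructor symbols. -/
def IsPartialCTerm {n : ℕ} : Expr S n → Prop
  | var _ => True
  | bot => True
  | app (Sum.inl _) args => ∀ i, (args i).IsPartialCTerm
  | app (Sum.inr _) _ => False
  | letE _ _ => False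

/-- `CTerm`: the (total) c-terms. -/
def IsCTerm {n : ℕ} (e : Expr S n) : Prop := e.IsPartialCTerm ∧ e.IsTotal

/-- The expression is of the form `f(…)` with `f ∈ FS`. -/
def IsFunApp {n : ℕ} : Expr S n → Prop
  | app (Sum.inr _) _ => True
  | _ => False

/-- The expression is of the form `let Y = e' in e''`. -/
def IsLet {n : ℕ} : Expr S n → Prop
  | letE _ _ => True
  | _ => False

/-! ### Renaming and substitution -/

/-- A visible variable, seen from below one more let-binder. -/
def _root_.LetRewriting.Scope.shift {n : ℕ} : Scope n → Scope (n + 1) := Sum.map id Fin.succ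

/-- A renaming, extended to the scope of one more let-binder. -/
def liftRen {n m : ℕ} (ρ : Scope n → Scope m) : Scope (n + 1) → Scope (m + 1)
  | Sum.inl x => Scope.shift (ρ (Sum.inl x))
  | Sum.inr i => Fin.cases (Sum.inr 0) (fun j => Scope.shift (ρ (Sum.inr j))) i

def rename {n m : ℕ} (ρ : Scope n → Scope m) : Expr S n → Expr S m
  | var X => var (ρ X)
  | bot => bot
  | app h args => app h fun i => (args i).rename ρ
  | letE e₁ e₂ => letE (e₁.rename ρ) (e₂.rename (liftRen ρ))

/-- The same expression, moved below one more let-binder (whose variable does not occur in it). -/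
def weaken {n : ℕ} : Expr S n → Expr S (n + 1) := rename Scope.shift

/-- A substitution, extended to the scope of one more let-binder without capture. -/
def liftSub {n m : ℕ} (σ : Scope n → Expr S m) : Scope (n + 1) → Expr S (m + 1)
  | Sum.inl x => (σ (Sum.inl x)).weaken
  | Sum.inr i => Fin.cases (var (Sum.inr 0)) (fun j => (σ (Sum.inr j)).weaken) i

/-- Simultaneous capture-avoiding substitution for all visible variables. -/
def bindVars {n m : ℕ} (σ : Scope n → Expr S m) : Expr S n → Expr S m
  | var X => σ X
  | bot => bot
  | app h args => app h fun i => (args i).bindVars σ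
  | letE e₁ e₂ => letE (e₁.bindVars σ) (e₂.bindVars (liftSub σ))

/-- `e[X/t]` for the body `e` of a let-expression that binds `X`. -/
def inst {n : ℕ} (e : Expr S (n + 1)) (t : Expr S n) : Expr S n :=
  e.bindVars fun
    | Sum.inl x => var (Sum.inl x)
    | Sum.inr i => Fin.cases t (fun j => var (Sum.inr j)) i

/-- `eθ`, where `e` has no variables bound from outside. The values of `θ` may contain let-bound
variables of the place where `eθ` is put. -/
def subst {m : ℕ} (e : Expr S 0) (θ : Var → Expr S m) : Expr S m :=
  e.bindVars (Sum.elim θ Fin.elim0)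

/-! ### Variables -/

/-- `FV(e)`, the variables occurring in `e` that are not bound within `e`. -/
def FV {n : ℕ} : Expr S n → Set (Scope n)
  | var X => {X}
  | bot => ∅
  | app _ args => ⋃ i, (args i).FV
  | letE e₁ e₂ => e₁.FV ∪ Scope.shift ⁻¹' e₂.FV

/-- The number of occurrences of the free variable `x` in `e`. -/
def occ {n : ℕ} (x : Var) : Expr S n → ℕ
  | var (Sum.inl y) => if y = x then 1 else 0
  | var (Sum.inr _) => 0
  | bot => 0
  | app _ args => ∑ i, (args i).occ x
  | letE e₁ e₂ => e₁.occ x + e₂.occ x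

/-! ### Shell and approximation ordering -/

/-- The shell `|e|`. -/
def shell {n : ℕ} : Expr S n → Expr S n
  | var X => var X
  | bot => bot
  | app (Sum.inl c) args => app (Sum.inl c) fun i => (args i).shell
  | app (Sum.inr _) _ => bot
  | letE e₁ e₂ => e₂.shell.inst e₁.shell

/-- The approximation ordering `⊑`: the least partial ordering with `⊥ ⊑ e` that is closed under
contexts. -/
inductive Approx : {n : ℕ} → Expr S n → Expr S n → Prop
  | bot {n : ℕ} (e : Expr S n) : Approx Expr.bot e
  | var {n : ℕ} (X : Scope n) : Approx (Expr.var X) (Expr.var X)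
  | app {n : ℕ} (h : S.Sym) (args args' : Fin (S.arity h) → Expr S n) :
      (∀ i, Approx (args i) (args' i)) → Approx (Expr.app h args) (Expr.app h args')
  | letE {n : ℕ} (e₁ e₁' : Expr S n) (e₂ e₂' : Expr S (n + 1)) :
      Approx e₁ e₁' → Approx e₂ e₂' → Approx (Expr.letE e₁ e₂) (Expr.letE e₁' e₂')

end Expr

open LetRewriting.Expr

/-! ### Substitutions and programs -/

/-- The domain of a substitution. -/
def substDom {m : ℕ} (θ : Var → Expr S m) : Set Var := {x | θ x ≠ var (Sum.inl x)}

/-- `CSubst_⊥`: substitutions of finite domain whose values are partial c-terms. -/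
def IsPartialCSubst {m : ℕ} (θ : Var → Expr S m) : Prop :=
  (substDom θ).Finite ∧ ∀ x, (θ x).IsPartialCTerm

/-- `CSubst`: substitutions of finite domain whose values are c-terms. -/
def IsCSubst {m : ℕ} (θ : Var → Expr S m) : Prop :=
  (substDom θ).Finite ∧ ∀ x, (θ x).IsCTerm

/-- A program rule `f(p₁,…,pₙ) → r`: `(p₁,…,pₙ)` is a linear tuple of c-terms and `r ∈ LExp`;
extra variables in `r` are allowed. -/
structure Rule (S : Signature.{u, v}) where
  f : S.FS
  lhs : Fin (S.arity (Sum.inr f)) → Expr S 0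
  rhs : Expr S 0
  lhs_cterm : ∀ i, (lhs i).IsCTerm
  lhs_linear : ∀ x, ∑ i, (lhs i).occ x ≤ 1
  rhs_total : rhs.IsTotal

/-- The variables `var(p₁,…,pₙ)` of the left-hand side of a rule. -/
def Rule.lhsVars (R : Rule S) : Set Var := {x | ∃ i, Sum.inl x ∈ (R.lhs i).FV}

/-- A program is any set of program rules. -/
abbrev Program (S : Signature.{u, v}) : Type (max u v) := Set (Rule S)

/-- The program has no lets. -/
def Program.LetFree (P : Program S) : Prop := ∀ R ∈ P, R.rhs.LetFree

/-! ### The proof calculi -/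

/-- Derivability `P ⊢_CRWL e → t` in the CRWL calculus, whose statements are about `e ∈ Exp_⊥`
and `t ∈ CTerm_⊥`. -/
inductive CRWL (P : Program S) : Expr S 0 → Expr S 0 → Prop
  | B (e : Expr S 0) : e.LetFree → CRWL P e bot
  | RR (x : Var) : CRWL P (var (Sum.inl x)) (var (Sum.inl x))
  | DC (c : S.CS) (es ts : Fin (S.arity (Sum.inl c)) → Expr S 0) :
      (∀ i, CRWL P (es i) (ts i)) → CRWL P (app (Sum.inl c) es) (app (Sum.inl c) ts)
  | OR (R : Rule S) (θ : Var → Expr S 0) (es : Fin (S.arity (Sum.inr R.f)) → Expr S 0)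
      (t : Expr S 0) :
      R ∈ P → IsPartialCSubst θ → (∀ i, CRWL P (es i) ((R.lhs i).subst θ)) →
      CRWL P (R.rhs.subst θ) t → CRWL P (app (Sum.inr R.f) es) t

/-- Derivability `P ⊢_CRWLlet e → t` in the calculus CRWL_let, whose statements are about
`e ∈ LExp_⊥` and `t ∈ CTerm_⊥`. -/
inductive CRWLlet (P : Program S) : Expr S 0 → Expr S 0 → Prop
  | B (e : Expr S 0) : CRWLlet P e bot
  | RR (x : Var) : CRWLlet P (var (Sum.inl x)) (var (Sum.inl x))
  | DC (c : S.CS) (es ts : Fin (S.arity (Sum.inl c)) → Expr S 0) :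
      (∀ i, CRWLlet P (es i) (ts i)) → CRWLlet P (app (Sum.inl c) es) (app (Sum.inl c) ts)
  | OR (R : Rule S) (θ : Var → Expr S 0) (es : Fin (S.arity (Sum.inr R.f)) → Expr S 0)
      (t : Expr S 0) :
      R ∈ P → IsPartialCSubst θ → (∀ i, CRWLlet P (es i) ((R.lhs i).subst θ)) →
      CRWLlet P (R.rhs.subst θ) t → CRWLlet P (app (Sum.inr R.f) es) t
  | Let (e₁ : Expr S 0) (e₂ : Expr S 1) (t₁ t : Expr S 0) :
      CRWLlet P e₁ t₁ → CRWLlet P (e₂.inst t₁) t → CRWLlet P (letE e₁ e₂) t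

/-! ### Let-rewriting -/

/-- One step of let-rewriting, at a position below `n` let-binders of the surrounding context;
the relation on `LExp` is the case `n = 0`. The three rules `contx…` give the closure under
contexts. The variables bound by the context around the position are the `Sum.inr j`, so the
last premise of `fapp` says that `θ`, restricted to the variables not in the left-hand side of
the rule, introduces no variable that is bound by the context (for `n = 0` it is void). The
freshness conditions of `letIn` and `flat` hold by construction. -/
inductive LetStep (P : Program S) : {n : ℕ} → Expr S n → Expr S n → Prop
  | fapp {n : ℕ} (R : Rule S) (θ : Var → Expr S n) :
      R ∈ P → IsCSubst θ →
      (∀ x, x ∉ R.lhsVars → ∀ j : Fin n, Sum.inr j ∉ (θ x).FV) →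
      LetStep P (app (Sum.inr R.f) fun i => (R.lhs i).subst θ) (R.rhs.subst θ)
  | letIn {n : ℕ} (h : S.Sym) (args : Fin (S.arity h) → Expr S n) (i : Fin (S.arity h)) :
      (args i).IsFunApp ∨ (args i).IsLet →
      LetStep P (app h args)
        (letE (args i) (app h (Function.update (fun k => (args k).weaken) i (var (Sum.inr 0)))))
  | bind {n : ℕ} (t : Expr S n) (e : Expr S (n + 1)) :
      t.IsCTerm → LetStep P (letE t e) (e.inst t)
  | elim {n : ℕ} (e₁ e₂ : Expr S n) : LetStep P (letE e₁ e₂.weaken) e₂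
  | flat {n : ℕ} (e₁ : Expr S n) (e₂ e₃ : Expr S (n + 1)) :
      LetStep P (letE (letE e₁ e₂) e₃) (letE e₁ (letE e₂ (e₃.rename (liftRen Scope.shift))))
  | contxApp {n : ℕ} (h : S.Sym) (args : Fin (S.arity h) → Expr S n) (i : Fin (S.arity h))
      (e' : Expr S n) :
      LetStep P (args i) e' → LetStep P (app h args) (app h (Function.update args i e'))
  | contxDef {n : ℕ} (e₁ e₁' : Expr S n) (e₂ : Expr S (n + 1)) :
      LetStep P e₁ e₁' → LetStep P (letE e₁ e₂) (letE e₁' e₂)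
  | contxBody {n : ℕ} (e₁ : Expr S n) (e₂ e₂' : Expr S (n + 1)) :
      LetStep P e₂ e₂' → LetStep P (letE e₁ e₂) (letE e₁ e₂')

/-- Let-rewriting derivations `e →ˡ* e'`. -/
def LetRewrites (P : Program S) : Expr S 0 → Expr S 0 → Prop :=
  Relation.ReflTransGen (LetStep P)

end LetRewriting

namespace LetRewriting

variable {S : Signature.{u, v}}

namespace Expr

/-! ### Algebra of substitutions -/

/-! A derivation may instantiate a let-bound variable by a partial c-term, whereas (Bind) needs a
total one. The remedy is to keep lets that bind function applications and to read their variables as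
`⊥`, the shell of what they bind; `close` does this reading. The claim proved by induction on
derivations, `CRWLlet.exists_letSteps`, is: if `e` derives `t` and `e ⊑ a.close` with `a` total,
then `a` rewrites to some `a'` with `t ⊑ a'.shell.close`. The premise `e ⊑ a.close` builds in the
monotonicity of derivations.

Rewriting never decreases shells, so results may be brought to let-normal form
(`exists_isLetNormal`). In the (OR) and (Let) cases, (LetIn) and (Flat) then float lets outwards
until only c-terms and bound variables standing for `⊥` remain (`letE_of_isLetNormal`,
`app_of_isLetNormal`). A linear left-hand side matches such c-terms, and the `⊥` in the values of
extra variables can be filled in, so (Fapp) applies (`exists_letStep_of_approx`).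

For total `t`, the inequality `t ⊑ |e'|` is an equality, and (Bind) and (Elim) rewrite `e'` to its
shell (`letSteps_shell`). CRWL derivations are also CRWL_let derivations. -/

/-- The substitution `σ`, extended by the value `u` for the innermost let-bound variable. -/
def extSub {n m : ℕ} (σ : Scope n → Expr S m) (u : Expr S m) : Scope (n + 1) → Expr S m
  | Sum.inl x => σ (Sum.inl x)
  | Sum.inr i => Fin.cases u (fun j => σ (Sum.inr j)) i

theorem inst_eq {n : ℕ} (e : Expr S (n + 1)) (u : Expr S n) :
    e.inst u = e.bindVars (extSub var u) := by
  unfold inst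
  congr 1

/-- Free and outer bound variables are both shifts, so binder cases reduce to the innermost variable
and `X.shift`. -/
theorem forall_scope_succ {n : ℕ} {p : Scope (n + 1) → Prop} :
    (∀ X, p X) ↔ p (Sum.inr 0) ∧ ∀ X : Scope n, p X.shift := by
  refine ⟨fun h => ⟨h _, fun X => h _⟩, fun h X => ?_⟩
  rcases X with x | i
  · exact h.2 (Sum.inl x)
  · refine Fin.cases h.1 (fun j => ?_) i
    exact h.2 (Sum.inr j)

theorem funext_scope_succ {n : ℕ} {α : Type*} {f g : Scope (n + 1) → α}
    (h0 : f (Sum.inr 0) = g (Sum.inr 0)) (h : ∀ X : Scope n, f X.shift = g X.shift) : f = g :=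
  funext (forall_scope_succ.2 ⟨h0, h⟩)

@[simp] theorem liftRen_zero {n m : ℕ} (ρ : Scope n → Scope m) :
    liftRen ρ (Sum.inr 0) = Sum.inr 0 := rfl

@[simp] theorem liftRen_shift {n m : ℕ} (ρ : Scope n → Scope m) (X : Scope n) :
    liftRen ρ X.shift = (ρ X).shift := by
  cases X <;> rfl

@[simp] theorem liftSub_shift {n m : ℕ} (σ : Scope n → Expr S m) (X : Scope n) :
    liftSub σ X.shift = (σ X).weaken := by
  cases X <;> rfl

@[simp] theorem extSub_zero {n m : ℕ} (σ : Scope n → Expr S m) (u : Expr S m) :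
    extSub σ u (Sum.inr 0) = u := rfl

@[simp] theorem extSub_shift {n m : ℕ} (σ : Scope n → Expr S m) (u : Expr S m) (X : Scope n) :
    extSub σ u X.shift = σ X := by
  cases X <;> rfl

theorem rename_eq_bindVars {n m : ℕ} (e : Expr S n) (ρ : Scope n → Scope m) :
    e.rename ρ = e.bindVars fun X => var (ρ X) := by
  induction e generalizing m with
  | var X => rfl
  | bot => rfl
  | app h args ih => simp only [rename, bindVars, ih]
  | letE e₁ e₂ ih₁ ih₂ =>
    simp only [rename, bindVars, ih₁, ih₂]
    congr 2
    exact funext_scope_succ rfl fun X => by simp [weaken, rename]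

theorem liftSub_var {n : ℕ} : liftSub (var : Scope n → Expr S n) = var :=
  funext_scope_succ rfl fun X => by simp [weaken, rename]

theorem bindVars_var {n : ℕ} (e : Expr S n) : e.bindVars var = e := by
  induction e with
  | var X => rfl
  | bot => rfl
  | app h args ih => simp only [bindVars, ih]
  | letE e₁ e₂ ih₁ ih₂ =>
    simp only [bindVars, ih₁, liftSub_var, ih₂]

/-- The composition laws involving renamings come before `bindVars_bindVars`, because `liftSub`
weakens the values of a substitution. -/
theorem bindVars_rename {n m k : ℕ} (e : Expr S n) (ρ : Scope n → Scope m)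
    (σ : Scope m → Expr S k) : (e.rename ρ).bindVars σ = e.bindVars fun X => σ (ρ X) := by
  induction e generalizing m k with
  | var X => rfl
  | bot => rfl
  | app h args ih => simp only [rename, bindVars, ih]
  | letE e₁ e₂ ih₁ ih₂ =>
    simp only [rename, bindVars, ih₁, ih₂]
    congr 2
    exact funext_scope_succ rfl fun X => by simp

theorem rename_rename {n m k : ℕ} (e : Expr S n) (ρ : Scope n → Scope m)
    (τ : Scope m → Scope k) : (e.rename ρ).rename τ = e.rename fun X => τ (ρ X) := by
  rw [rename_eq_bindVars _ τ, bindVars_rename, rename_eq_bindVars]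

theorem rename_bindVars {n m k : ℕ} (e : Expr S n) (σ : Scope n → Expr S m)
    (ρ : Scope m → Scope k) : (e.bindVars σ).rename ρ = e.bindVars fun X => (σ X).rename ρ := by
  induction e generalizing m k with
  | var X => rfl
  | bot => rfl
  | app h args ih => simp only [rename, bindVars, ih]
  | letE e₁ e₂ ih₁ ih₂ =>
    simp only [rename, bindVars, ih₁, ih₂]
    congr 2
    exact funext_scope_succ rfl fun X => by simp [weaken, rename_rename]

theorem bindVars_bindVars {n m k : ℕ} (e : Expr S n) (σ : Scope n → Expr S m)
    (τ : Scope m → Expr S k) :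
    (e.bindVars σ).bindVars τ = e.bindVars fun X => (σ X).bindVars τ := by
  induction e generalizing m k with
  | var X => rfl
  | bot => rfl
  | app h args ih => simp only [bindVars, ih]
  | letE e₁ e₂ ih₁ ih₂ =>
    simp only [bindVars, ih₁, ih₂]
    congr 2
    exact funext_scope_succ rfl fun X => by simp [weaken, bindVars_rename, rename_bindVars]

theorem weaken_bindVars_extSub {n m : ℕ} (e : Expr S n) (σ : Scope n → Expr S m)
    (u : Expr S m) : e.weaken.bindVars (extSub σ u) = e.bindVars σ := by
  simp [weaken, bindVars_rename]

@[simp] theorem weaken_inst {n : ℕ} (e u : Expr S n) : e.weaken.inst u = e := by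
  rw [inst_eq, weaken_bindVars_extSub, bindVars_var]

theorem bindVars_liftSub_inst {n m : ℕ} (e : Expr S (n + 1)) (σ : Scope n → Expr S m)
    (u : Expr S m) : (e.bindVars (liftSub σ)).inst u = e.bindVars (extSub σ u) := by
  rw [inst_eq, bindVars_bindVars]
  congr 1
  exact funext_scope_succ rfl fun X => by simp [weaken_bindVars_extSub, bindVars_var]

theorem inst_bindVars {n m : ℕ} (e : Expr S (n + 1)) (u : Expr S n) (σ : Scope n → Expr S m) :
    (e.inst u).bindVars σ = e.bindVars (extSub σ (u.bindVars σ)) := by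
  rw [inst_eq, bindVars_bindVars]
  congr 1
  exact funext_scope_succ rfl fun X => by simp [bindVars]

theorem inst_rename_liftRen {n m : ℕ} (e : Expr S (n + 1)) (ρ : Scope n → Scope m)
    (u : Expr S n) : (e.inst u).rename ρ = (e.rename (liftRen ρ)).inst (u.rename ρ) := by
  rw [rename_eq_bindVars, inst_bindVars, inst_eq, bindVars_rename, ← rename_eq_bindVars]
  congr 1
  exact funext_scope_succ rfl fun X => by simp

theorem weaken_rename_liftRen {n m : ℕ} (e : Expr S n) (ρ : Scope n → Scope m) :
    e.weaken.rename (liftRen ρ) = (e.rename ρ).weaken := by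
  simp [weaken, rename_rename]

theorem bindVars_congr {n m : ℕ} (e : Expr S n) {σ τ : Scope n → Expr S m}
    (h : ∀ X ∈ e.FV, σ X = τ X) : e.bindVars σ = e.bindVars τ := by
  induction e generalizing m with
  | var X => exact h X rfl
  | bot => rfl
  | app f args ih =>
    simp only [bindVars]
    congr 1
    funext i
    exact ih i fun X hX => h X (Set.mem_iUnion.2 ⟨i, hX⟩)
  | letE e₁ e₂ ih₁ ih₂ =>
    simp only [bindVars]
    rw [ih₁ fun X hX => h X (Or.inl hX)]
    congr 1
    refine ih₂ (forall_scope_succ.2 ⟨fun _ => rfl, fun X hX => ?_⟩)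
    simp only [liftSub_shift]
    rw [h X (Or.inr hX)]

/-! ### Total expressions and c-terms -/

theorem IsTotal.bindVars {n m : ℕ} {e : Expr S n} {σ : Scope n → Expr S m} (he : e.IsTotal)
    (hσ : ∀ X, (σ X).IsTotal) : (e.bindVars σ).IsTotal := by
  have hren : ∀ {n m : ℕ} {e : Expr S n} (ρ : Scope n → Scope m), e.IsTotal →
      (e.rename ρ).IsTotal := by
    intro n m e ρ he
    induction e generalizing m with
    | var X => trivial
    | bot => exact he
    | app h args ih => exact fun i => ih i ρ (he i)
    | letE e₁ e₂ ih₁ ih₂ => exact ⟨ih₁ ρ he.1, ih₂ _ he.2⟩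
  induction e generalizing m with
  | var X => exact hσ X
  | bot => exact he
  | app h args ih => exact fun i => ih i (he i) hσ
  | letE e₁ e₂ ih₁ ih₂ =>
    refine ⟨ih₁ he.1 hσ, ih₂ he.2 (forall_scope_succ.2 ⟨trivial, fun X => ?_⟩)⟩
    rw [liftSub_shift]
    exact hren _ (hσ X)

theorem IsTotal.rename {n m : ℕ} {e : Expr S n} (he : e.IsTotal) (ρ : Scope n → Scope m) :
    (e.rename ρ).IsTotal := by
  rw [rename_eq_bindVars]
  exact he.bindVars fun _ => trivial

theorem IsTotal.inst {n : ℕ} {e : Expr S (n + 1)} {u : Expr S n} (he : e.IsTotal)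
    (hu : u.IsTotal) : (e.inst u).IsTotal := by
  rw [inst_eq]
  refine he.bindVars (forall_scope_succ.2 ⟨hu, fun X => ?_⟩)
  rw [extSub_shift]
  trivial

theorem IsTotal.of_bindVars {n m : ℕ} {e : Expr S n} {σ : Scope n → Expr S m}
    (he : (e.bindVars σ).IsTotal) : e.IsTotal := by
  induction e generalizing m with
  | var X => trivial
  | bot => exact he
  | app h args ih => exact fun i => ih i (he i)
  | letE e₁ e₂ ih₁ ih₂ => exact ⟨ih₁ he.1, ih₂ he.2⟩

theorem IsPartialCTerm.bindVars {n m : ℕ} {e : Expr S n} {σ : Scope n → Expr S m}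
    (he : e.IsPartialCTerm) (hσ : ∀ X, (σ X).IsPartialCTerm) :
    (e.bindVars σ).IsPartialCTerm := by
  induction e generalizing m with
  | var X => exact hσ X
  | bot => trivial
  | app h args ih =>
    cases h with
    | inl c => exact fun i => ih i (he i) hσ
    | inr f => exact he
  | letE e₁ e₂ ih₁ ih₂ => exact he.elim

theorem IsPartialCTerm.rename {n m : ℕ} {e : Expr S n} (he : e.IsPartialCTerm)
    (ρ : Scope n → Scope m) : (e.rename ρ).IsPartialCTerm := by
  rw [rename_eq_bindVars]
  exact he.bindVars fun _ => trivial

theorem IsPartialCTerm.inst {n : ℕ} {e : Expr S (n + 1)} {u : Expr S n}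
    (he : e.IsPartialCTerm) (hu : u.IsPartialCTerm) : (e.inst u).IsPartialCTerm := by
  rw [inst_eq]
  refine he.bindVars (forall_scope_succ.2 ⟨hu, fun X => ?_⟩)
  rw [extSub_shift]
  trivial

theorem IsCTerm.bindVars {n m : ℕ} {e : Expr S n} {σ : Scope n → Expr S m} (he : e.IsCTerm)
    (hσ : ∀ X, (σ X).IsCTerm) : (e.bindVars σ).IsCTerm :=
  ⟨he.1.bindVars fun X => (hσ X).1, he.2.bindVars fun X => (hσ X).2⟩

theorem IsCTerm.rename {n m : ℕ} {e : Expr S n} (he : e.IsCTerm) (ρ : Scope n → Scope m) :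
    (e.rename ρ).IsCTerm :=
  ⟨he.1.rename ρ, he.2.rename ρ⟩

theorem isCTerm_var {n : ℕ} (X : Scope n) : (var X : Expr S n).IsCTerm := ⟨trivial, trivial⟩

theorem IsFunApp.bindVars {n m : ℕ} {e : Expr S n} {σ : Scope n → Expr S m}
    (he : e.IsFunApp) : (e.bindVars σ).IsFunApp := by
  cases e with
  | app h args =>
    cases h with
    | inl c => exact he.elim
    | inr f => trivial
  | _ => exact he.elim

/-- For a partial c-term, either the innermost bound variable does not occur, or a total
instance has a total value for it. -/
theorem IsPartialCTerm.eq_weaken_or_isTotal {n : ℕ} {e : Expr S (n + 1)} {u : Expr S n}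
    (he : e.IsPartialCTerm) (h : (e.inst u).IsTotal) : (∃ e', e = weaken e') ∨ u.IsTotal := by
  by_cases hu : u.IsTotal
  · exact Or.inr hu
  left
  -- Induction on `e` needs a variable scope index, so `n + 1` becomes `k` with an equation.
  suffices H : ∀ {k : ℕ} (e : Expr S k) (hk : k = n + 1), e.IsPartialCTerm →
      ((hk ▸ e : Expr S (n + 1)).inst u).IsTotal →
      ∃ e', (hk ▸ e : Expr S (n + 1)) = weaken e' from H e rfl he h
  intro k e
  induction e with
  | var X =>
    rintro rfl - h
    revert X
    refine forall_scope_succ.2 ⟨fun h => (hu h).elim, fun X _ => ⟨var X, rfl⟩⟩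
  | bot =>
    rintro rfl - h
    exact h.elim
  | app f args ih =>
    rintro rfl he h
    cases f with
    | inl c =>
      choose e' he' using fun i => ih i rfl (he i) (h i)
      exact ⟨app (Sum.inl c) e', congrArg (app (Sum.inl c)) (funext he')⟩
    | inr f => exact he.elim
  | letE e₁ e₂ ih₁ ih₂ =>
    intro _ he
    exact he.elim

/-! ### The approximation ordering -/

theorem Approx.refl {n : ℕ} (e : Expr S n) : Approx e e := by
  induction e with
  | var X => exact .var X
  | bot => exact .bot _
  | app h args ih => exact .app _ _ _ ih
  | letE e₁ e₂ ih₁ ih₂ => exact .letE _ _ _ _ ih₁ ih₂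

theorem Approx.of_eq {n : ℕ} {e e' : Expr S n} (h : e = e') : Approx e e' := h ▸ Approx.refl e

theorem Approx.trans {n : ℕ} {a b c : Expr S n} (hab : Approx a b) (hbc : Approx b c) :
    Approx a c := by
  induction hab with
  | bot e => exact .bot _
  | var X => exact hbc
  | app h as bs _ ih =>
    cases hbc with
    | app _ _ cs hcs => exact .app _ _ _ fun i => ih i (hcs i)
  | letE a₁ b₁ a₂ b₂ _ _ ih₁ ih₂ =>
    cases hbc with
    | letE _ c₁ _ c₂ h₁ h₂ => exact .letE _ _ _ _ (ih₁ h₁) (ih₂ h₂)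

theorem Approx.eq_bot {n : ℕ} {a : Expr S n} (h : Approx a Expr.bot) : a = Expr.bot := by
  cases h
  rfl

/-- Strict increase can only happen at an occurrence of `⊥`, so total expressions are maximal. -/
theorem Approx.eq_of_isTotal {n : ℕ} {a b : Expr S n} (h : Approx a b) (ha : a.IsTotal) :
    a = b := by
  induction h with
  | bot e => exact ha.elim
  | var X => rfl
  | app f as bs _ ih => exact congrArg (Expr.app f) (funext fun i => ih i (ha i))
  | letE a₁ b₁ a₂ b₂ _ _ ih₁ ih₂ => rw [ih₁ ha.1, ih₂ ha.2]

theorem Approx.bindVars {n m : ℕ} {e e' : Expr S n} {σ σ' : Scope n → Expr S m}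
    (h : Approx e e') (hσ : ∀ X, Approx (σ X) (σ' X)) :
    Approx (e.bindVars σ) (e'.bindVars σ') := by
  have hren : ∀ {n m : ℕ} {e e' : Expr S n} (ρ : Scope n → Scope m), Approx e e' →
      Approx (e.rename ρ) (e'.rename ρ) := by
    intro n m e e' ρ h
    induction h generalizing m with
    | bot e => exact .bot _
    | var X => exact .var _
    | app f as bs _ ih => exact .app _ _ _ fun i => ih i ρ
    | letE a₁ b₁ a₂ b₂ _ _ ih₁ ih₂ => exact .letE _ _ _ _ (ih₁ _) (ih₂ _)
  induction h generalizing m with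
  | bot e => exact .bot _
  | var X => exact hσ X
  | app f as bs _ ih => exact .app _ _ _ fun i => ih i hσ
  | letE a₁ b₁ a₂ b₂ _ _ ih₁ ih₂ =>
    refine .letE _ _ _ _ (ih₁ hσ) (ih₂ (forall_scope_succ.2 ⟨.var _, fun X => ?_⟩))
    simp only [liftSub_shift]
    exact hren _ (hσ X)

theorem Approx.inst {n : ℕ} {e e' : Expr S (n + 1)} {u u' : Expr S n} (h : Approx e e')
    (hu : Approx u u') : Approx (e.inst u) (e'.inst u') := by
  rw [inst_eq, inst_eq]
  refine h.bindVars (forall_scope_succ.2 ⟨hu, fun X => ?_⟩)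
  simp only [extSub_shift]
  exact .refl _

/-! ### Shells -/

theorem shell_isPartialCTerm {n : ℕ} (e : Expr S n) : e.shell.IsPartialCTerm := by
  induction e with
  | var X => trivial
  | bot => trivial
  | app h args ih =>
    cases h with
    | inl c => exact ih
    | inr f => trivial
  | letE e₁ e₂ ih₁ ih₂ => exact ih₂.inst ih₁

theorem IsPartialCTerm.shell_eq {n : ℕ} {e : Expr S n} (he : e.IsPartialCTerm) :
    e.shell = e := by
  induction e with
  | var X => rfl
  | bot => rfl
  | app h args ih =>
    cases h with
    | inl c => exact congrArg (app (Sum.inl c)) (funext fun i => ih i (he i))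
    | inr f => exact he.elim
  | letE e₁ e₂ ih₁ ih₂ => exact he.elim

theorem IsFunApp.shell_eq {n : ℕ} {e : Expr S n} (he : e.IsFunApp) : e.shell = bot := by
  cases e with
  | app h args =>
    cases h with
    | inl c => exact he.elim
    | inr f => rfl
  | _ => exact he.elim

theorem shell_rename {n m : ℕ} (e : Expr S n) (ρ : Scope n → Scope m) :
    (e.rename ρ).shell = e.shell.rename ρ := by
  induction e generalizing m with
  | var X => rfl
  | bot => rfl
  | app h args ih =>
    cases h with
    | inl c => simp only [rename, shell, ih]
    | inr f => rfl
  | letE e₁ e₂ ih₁ ih₂ => simp only [rename, shell, ih₁, ih₂, inst_rename_liftRen]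

/-- No assumption on `σ` is needed: function applications are discarded along with what is
substituted in them, and lets are resolved by substituting shells. -/
theorem shell_bindVars {n m : ℕ} (e : Expr S n) (σ : Scope n → Expr S m) :
    (e.bindVars σ).shell = e.shell.bindVars fun X => (σ X).shell := by
  induction e generalizing m with
  | var X => rfl
  | bot => rfl
  | app h args ih =>
    cases h with
    | inl c => simp only [bindVars, shell, ih]
    | inr f => rfl
  | letE e₁ e₂ ih₁ ih₂ =>
    simp only [bindVars, shell, ih₁, ih₂, inst_bindVars]
    rw [← bindVars_liftSub_inst]
    congr 2
    exact funext_scope_succ rfl fun X => by simp [weaken, shell_rename]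

theorem shell_inst {n : ℕ} (e : Expr S (n + 1)) (u : Expr S n) :
    (e.inst u).shell = e.shell.inst u.shell := by
  rw [inst_eq, inst_eq, shell_bindVars]
  congr 1
  exact funext_scope_succ rfl fun X => by simp [shell]

end Expr

variable {P : Program S}

open LetRewriting.Expr

/-! ### Let-rewriting steps -/

theorem LetStep.isTotal {n : ℕ} {e e' : Expr S n} (h : LetStep P e e') (he : e.IsTotal) :
    e'.IsTotal := by
  induction h with
  | fapp R θ hR hθ hx =>
    exact R.rhs_total.bindVars fun X => X.casesOn (fun x => (hθ.2 x).2) (fun i => i.elim0)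
  | letIn h args i hi =>
    refine ⟨he i, fun k => ?_⟩
    rcases eq_or_ne k i with rfl | hk
    · rw [Function.update_self]
      trivial
    · rw [Function.update_of_ne hk]
      exact (he k).rename _
  | bind t e ht => exact he.2.inst he.1
  | elim e₁ e₂ =>
    have := he.2
    rw [weaken, rename_eq_bindVars] at this
    exact this.of_bindVars
  | flat e₁ e₂ e₃ => exact ⟨he.1.1, he.1.2, he.2.rename _⟩
  | contxApp h args i e' _ ih =>
    intro k
    rcases eq_or_ne k i with rfl | hk
    · rw [Function.update_self]
      exact ih (he k)
    · rw [Function.update_of_ne hk]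
      exact he k
  | contxDef e₁ e₁' e₂ _ ih => exact ⟨ih he.1, he.2⟩
  | contxBody e₁ e₂ e₂' _ ih => exact ⟨he.1, ih he.2⟩

theorem Expr.shell_app_approx {n : ℕ} {h : S.Sym} {args args' : Fin (S.arity h) → Expr S n}
    (H : ∀ i, Approx (args i).shell (args' i).shell) :
    Approx (app h args).shell (app h args').shell := by
  cases h with
  | inl c => exact .app _ _ _ H
  | inr f => exact .bot _

/-- Let-rewriting does not decrease shells. -/
theorem LetStep.shell_approx {n : ℕ} {e e' : Expr S n} (h : LetStep P e e') :
    Approx e.shell e'.shell := by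
  induction h with
  | fapp R θ hR hθ hx => exact .bot _
  | letIn h args i hi =>
    cases h with
    | inr f => exact .bot _
    | inl c =>
      -- Resolving the new let puts the shell of the floated argument back in position `i`, so the
      -- shells are equal.
      refine .app _ _ _ fun k => .of_eq ?_
      change _ = Expr.inst (shell _) _
      rcases eq_or_ne k i with rfl | hk
      · rw [Function.update_self]
        rfl
      · rw [Function.update_of_ne hk, weaken, shell_rename]
        exact (weaken_inst _ _).symm
  | bind t e ht =>
    rw [shell_inst]
    exact .refl _
  | elim e₁ e₂ =>
    rw [shell, weaken, shell_rename]
    exact .of_eq (weaken_inst _ _)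
  | flat e₁ e₂ e₃ =>
    simp only [shell, shell_rename]
    refine .of_eq ?_
    -- Both sides instantiate the shell of `e₃` by the same value for its innermost variable.
    rw [inst_eq, inst_eq (inst _ _), inst_bindVars, bindVars_rename]
    congr 1
    exact funext_scope_succ (inst_eq _ _).symm fun X => by simp
  | contxApp h args i e' _ ih =>
    refine shell_app_approx fun k => ?_
    rcases eq_or_ne k i with rfl | hk
    · rw [Function.update_self]
      exact ih
    · rw [Function.update_of_ne hk]
      exact .refl _
  | contxDef e₁ e₁' e₂ _ ih => exact Approx.inst (.refl _) ih
  | contxBody e₁ e₂ e₂' _ ih => exact ih.inst (.refl _)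

/-- The reflexive-transitive closure of `LetStep` below `n` let-binders. -/
abbrev LetSteps (P : Program S) {n : ℕ} : Expr S n → Expr S n → Prop :=
  Relation.ReflTransGen (LetStep P)

theorem LetSteps.isTotal {n : ℕ} {e e' : Expr S n} (h : LetSteps P e e') (he : e.IsTotal) :
    e'.IsTotal := by
  induction h with
  | refl => exact he
  | tail _ hs ih => exact hs.isTotal ih

theorem LetSteps.shell_approx {n : ℕ} {e e' : Expr S n} (h : LetSteps P e e') :
    Approx e.shell e'.shell := by
  induction h with
  | refl => exact .refl _
  | tail _ hs ih => exact ih.trans hs.shell_approx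

theorem LetSteps.letE {n : ℕ} {e₁ e₁' : Expr S n} {e₂ e₂' : Expr S (n + 1)}
    (h₁ : LetSteps P e₁ e₁') (h₂ : LetSteps P e₂ e₂') :
    LetSteps P (letE e₁ e₂) (letE e₁' e₂') :=
  (Relation.ReflTransGen.lift (fun e => Expr.letE e e₂)
    (fun _ _ h => LetStep.contxDef _ _ _ h) _ _ h₁).trans
  (Relation.ReflTransGen.lift (fun e => Expr.letE e₁' e)
    (fun _ _ h => LetStep.contxBody _ _ _ h) _ _ h₂)

theorem LetSteps.update {n : ℕ} {h : S.Sym} (args : Fin (S.arity h) → Expr S n)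
    (i : Fin (S.arity h)) {e' : Expr S n} (H : LetSteps P (args i) e') :
    LetSteps P (app h args) (app h (Function.update args i e')) := by
  induction H with
  | refl => rw [Function.update_eq_self]
  | @tail a b _ hs ih =>
    refine ih.tail ?_
    have := LetStep.contxApp (P := P) h (Function.update args i a) i b
      (by rwa [Function.update_self])
    rwa [Function.update_idem] at this

theorem LetSteps.app {n : ℕ} {h : S.Sym} {args args' : Fin (S.arity h) → Expr S n}
    (H : ∀ i, LetSteps P (args i) (args' i)) : LetSteps P (app h args) (app h args') := by
  classical
  -- The arguments are rewritten one at a time; `s` holds the positions already done.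
  suffices ∀ s : Finset (Fin (S.arity h)),
      LetSteps P (Expr.app h args) (Expr.app h (s.piecewise args' args)) by
    simpa using this Finset.univ
  intro s
  induction s using Finset.induction_on with
  | empty => rw [Finset.piecewise_empty]
  | insert i s hi ih =>
    rw [Finset.piecewise_insert]
    refine ih.trans (LetSteps.update _ i ?_)
    rw [Finset.piecewise_eq_of_notMem _ _ _ hi]
    exact H i

/-- An expression whose shell is a c-term can be rewritten to its shell. -/
theorem letSteps_shell {n : ℕ} {e : Expr S n} (h : e.shell.IsTotal) : LetSteps P e e.shell := by
  induction e with
  | var X => exact .refl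
  | bot => exact .refl
  | app f args ih =>
    cases f with
    | inl c => exact LetSteps.app fun i => ih i (h i)
    | inr f => exact h.elim
  | letE e₁ e₂ ih₁ ih₂ =>
    have h₂ : e₂.shell.IsTotal := by
      have h' := h
      rw [shell, inst_eq] at h'
      exact h'.of_bindVars
    -- If the variable is absent from the shell of the body, (Elim) applies; otherwise the shell of
    -- `e₁` is total and (Bind) applies.
    rcases (shell_isPartialCTerm e₂).eq_weaken_or_isTotal h with ⟨e', he'⟩ | h₁
    · refine (LetSteps.letE .refl (ih₂ h₂)).tail ?_
      rw [shell, he', weaken_inst]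
      exact .elim _ _
    · exact (LetSteps.letE (ih₁ h₁) (ih₂ h₂)).tail (.bind _ _ ⟨shell_isPartialCTerm _, h₁⟩)

/-! ### Let-normal expressions -/

/-- A sequence of lets that bind applications of function symbols, around a body that is a c-term
or an application of a function symbol. -/
inductive IsLetNormal : {n : ℕ} → Expr S n → Prop
  | cterm {n : ℕ} {e : Expr S n} : e.IsCTerm → IsLetNormal e
  | funApp {n : ℕ} {e : Expr S n} : e.IsFunApp → IsLetNormal e
  | letE {n : ℕ} {a : Expr S n} {b : Expr S (n + 1)} :
      a.IsFunApp → IsLetNormal b → IsLetNormal (letE a b)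

theorem IsLetNormal.bindVars {n m : ℕ} {e : Expr S n} {σ : Scope n → Expr S m}
    (he : IsLetNormal e) (hσ : ∀ X, (σ X).IsCTerm) : IsLetNormal (e.bindVars σ) := by
  induction he generalizing m with
  | cterm h => exact .cterm (h.bindVars hσ)
  | funApp h => exact .funApp h.bindVars
  | letE h _ ih =>
    refine .letE h.bindVars (ih (forall_scope_succ.2 ⟨isCTerm_var _, fun X => ?_⟩))
    rw [liftSub_shift]
    exact (hσ X).rename _

theorem IsLetNormal.rename {n m : ℕ} {e : Expr S n} (he : IsLetNormal e)
    (ρ : Scope n → Scope m) : IsLetNormal (e.rename ρ) := by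
  rw [rename_eq_bindVars]
  exact he.bindVars fun _ => isCTerm_var _

theorem IsLetNormal.isCTerm_or {n : ℕ} {e : Expr S n} (he : IsLetNormal e) :
    e.IsCTerm ∨ e.IsFunApp ∨ e.IsLet := by
  cases he with
  | cterm h => exact Or.inl h
  | funApp h => exact Or.inr (Or.inl h)
  | letE _ _ => exact Or.inr (Or.inr trivial)

/-- The value of an expression when the variables bound from outside stand for `⊥`. -/
def Expr.close {n : ℕ} (e : Expr S n) : Expr S 0 :=
  e.bindVars (Sum.elim (fun x => var (Sum.inl x)) fun _ => bot)

/-- A property of expressions that is inherited against let-rewriting steps, and by lets that bind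
applications of function symbols. -/
structure IsBackClosed (P : Program S) (Q : ∀ {n : ℕ}, Expr S n → Prop) : Prop where
  step {n : ℕ} {e e' : Expr S n} : LetStep P e e' → Q e' → Q e
  letE {n : ℕ} {a : Expr S n} {b : Expr S (n + 1)} : a.IsFunApp → Q b → Q (Expr.letE a b)

theorem close_rename_shift {n : ℕ} (e : Expr S n) : (e.rename Scope.shift).close = e.close := by
  rw [close, bindVars_rename]
  congr 1
  funext X
  cases X <;> rfl

/-- The shell puts `⊥` for the bound variable, which is what `close` does: such lets are invisible
to closed shells. -/
theorem close_shell_letE {n : ℕ} {a : Expr S n} {b : Expr S (n + 1)} (ha : a.IsFunApp) :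
    (letE a b).shell.close = b.shell.close := by
  rw [shell, ha.shell_eq, close, inst_bindVars]
  congr 1
  exact funext_scope_succ rfl fun X => by cases X <;> rfl

/-- To handle a let that binds a let-normal expression, float the inner lets out; what remains is a
let that binds a c-term or an application of a function symbol. -/
theorem IsBackClosed.letE_of_isLetNormal {Q : ∀ {n : ℕ}, Expr S n → Prop}
    (hQ : IsBackClosed P Q) (B : ∀ {n : ℕ}, Expr S (n + 1) → Prop) {s : Expr S 0}
    (hren : ∀ {n : ℕ} {e : Expr S (n + 1)}, B e → B (e.rename (liftRen Scope.shift)))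
    (hinst : ∀ {n : ℕ} {e : Expr S (n + 1)} {u : Expr S n}, B e → u.IsCTerm →
      Approx s u.close → Q (e.inst u))
    (hbot : s = bot → ∀ {n : ℕ} {e : Expr S (n + 1)}, B e → Q e)
    {n : ℕ} {a : Expr S n} {e : Expr S (n + 1)} (ha : IsLetNormal a)
    (hs : Approx s a.shell.close) (he : B e) : Q (Expr.letE a e) := by
  -- Each (Flat) step renames the body and adds a binder around the remaining let; this is why `B`
  -- must survive renaming and live in every scope.
  induction ha with
  | cterm h =>
    rw [h.1.shell_eq] at hs
    exact hQ.step (.bind _ _ h) (hinst he h hs)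
  | funApp h =>
    rw [h.shell_eq] at hs
    -- Here `s = ⊥`, so the let can stay: its variable already stands for `⊥`.
    exact hQ.letE h (hbot hs.eq_bot he)
  | letE h _ ih =>
    rw [close_shell_letE h] at hs
    exact hQ.step (.flat _ _ _) (hQ.letE h (ih hs (hren he)))

/-- To handle an application to let-normal arguments, it is enough to handle applications to
c-terms. -/
theorem IsBackClosed.app_of_isLetNormal {Q : ∀ {n : ℕ}, Expr S n → Prop}
    (hQ : IsBackClosed P Q) (h : S.Sym) (s : Fin (S.arity h) → Expr S 0)
    (hc : ∀ {n : ℕ} (args : Fin (S.arity h) → Expr S n), (∀ i, (args i).IsCTerm) →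
      (∀ i, Approx (s i) (args i).close) → Q (app h args))
    {n : ℕ} (args : Fin (S.arity h) → Expr S n) (hargs : ∀ i, IsLetNormal (args i))
    (hs : ∀ i, Approx (s i) (args i).shell.close) : Q (app h args) := by
  -- Only positions in `L` may still hold something other than a c-term; the scope varies since each
  -- let floated out adds a binder.
  suffices H : ∀ (L : Finset (Fin (S.arity h))) {n : ℕ} (args : Fin (S.arity h) → Expr S n),
      (∀ i, IsLetNormal (args i) ∧ Approx (s i) (args i).shell.close ∧
        (i ∉ L → (args i).IsCTerm)) → Q (app h args) from
    H Finset.univ args fun i => ⟨hargs i, hs i, fun hi => (hi (Finset.mem_univ i)).elim⟩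
  intro L
  induction L using Finset.induction_on with
  | empty =>
    intro n args hargs
    have hct := fun i => (hargs i).2.2 (Finset.notMem_empty i)
    refine hc args hct fun i => ?_
    have := (hargs i).2.1
    rwa [(hct i).1.shell_eq] at this
  | insert i L hi ih =>
    intro n args hargs
    have hupd : ∀ {m : ℕ} (args : Fin (S.arity h) → Expr S m) (u : Expr S m),
        (∀ j, j ≠ i → IsLetNormal (args j) ∧ Approx (s j) (args j).shell.close ∧
          (j ∉ insert i L → (args j).IsCTerm)) → u.IsCTerm → Approx (s i) u.close →
        Q (app h (Function.update args i u)) := by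
      intro m args u hargs hu hsu
      refine ih _ fun j => ?_
      rcases eq_or_ne j i with rfl | hj
      · rw [Function.update_self]
        refine ⟨.cterm hu, ?_, fun _ => hu⟩
        rwa [hu.1.shell_eq]
      · rw [Function.update_of_ne hj]
        refine ⟨(hargs j hj).1, (hargs j hj).2.1, fun hjL => (hargs j hj).2.2 ?_⟩
        simp [hj, hjL]
    have hren : ∀ {m k : ℕ} (e : Expr S m) (j : Fin (S.arity h)) (ρ : Scope m → Scope k),
        (e.rename ρ).shell.close = e.shell.close →
        (IsLetNormal e ∧ Approx (s j) e.shell.close ∧ (j ∉ insert i L → e.IsCTerm)) →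
        IsLetNormal (e.rename ρ) ∧ Approx (s j) (e.rename ρ).shell.close ∧
          (j ∉ insert i L → (e.rename ρ).IsCTerm) := by
      intro m k e j ρ hρ ⟨h1, h2, h3⟩
      exact ⟨h1.rename ρ, hρ.symm ▸ h2, fun hj => (h3 hj).rename ρ⟩
    have hsh : ∀ {m : ℕ} (e : Expr S m), (e.rename Scope.shift).shell.close = e.shell.close :=
      fun e => by rw [shell_rename, close_rename_shift]
    have hmain : (args i).IsFunApp ∨ (args i).IsLet → Q (app h args) := by
      intro hi'
      refine hQ.step (.letIn h args i hi') ?_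
      -- The invariant is the shape of the body created by (LetIn); (Flat) preserves it up to
      -- weakening the other arguments.
      refine hQ.letE_of_isLetNormal (s := s i)
        (fun {m} e => ∃ args : Fin (S.arity h) → Expr S m,
          e = app h (Function.update (fun k => (args k).weaken) i (var (Sum.inr 0))) ∧
          ∀ j, j ≠ i → IsLetNormal (args j) ∧ Approx (s j) (args j).shell.close ∧
            (j ∉ insert i L → (args j).IsCTerm))
        ?_ ?_ ?_ (hargs i).1 (hargs i).2.1 ⟨args, rfl, fun j _ => hargs j⟩
      · rintro m _ ⟨args, rfl, hargs⟩
        refine ⟨fun j => (args j).weaken, ?_, fun j hj => hren _ j _ (hsh _) (hargs j hj)⟩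
        rw [Expr.rename]
        congr 1
        funext j
        rcases eq_or_ne j i with rfl | hj
        · simp [Expr.rename]
        · simp only [Function.update_of_ne hj, weaken_rename_liftRen]
          rfl
      · rintro m _ u ⟨args, rfl, hargs⟩ hu hsu
        have := hupd args u hargs hu hsu
        convert this using 1
        rw [inst_eq, Expr.bindVars]
        congr 1
        funext j
        rcases eq_or_ne j i with rfl | hj
        · simp [Expr.bindVars]
        · simp only [Function.update_of_ne hj, ← inst_eq, weaken_inst]
      -- The let stays, and its variable serves as the c-term in position `i`.
      · rintro hbot m _ ⟨args, rfl, hargs⟩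
        refine hupd _ _ (fun j hj => hren _ j _ (hsh _) (hargs j hj)) (isCTerm_var _) ?_
        rw [hbot]
        exact .bot _
    rcases (hargs i).1.isCTerm_or with hct | hfl
    · have := (hargs i).2.1
      rw [hct.1.shell_eq] at this
      simpa using hupd args (args i) (fun j _ => hargs j) hct this
    · exact hmain hfl

theorem isBackClosed_isLetNormal :
    IsBackClosed P fun {_} e => ∃ e', LetSteps P e e' ∧ IsLetNormal e' where
  step hs := fun ⟨e', h, hn⟩ => ⟨e', h.head hs, hn⟩
  letE ha := fun ⟨_, h, hn⟩ => ⟨_, LetSteps.letE .refl h, .letE ha hn⟩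

/-- Every total expression can be rewritten to a let-normal one. -/
theorem exists_isLetNormal {n : ℕ} {e : Expr S n} (he : e.IsTotal) :
    ∃ e', LetSteps P e e' ∧ IsLetNormal e' := by
  induction e with
  | var X => exact ⟨_, .refl, .cterm (isCTerm_var X)⟩
  | bot => exact he.elim
  | app h args ih =>
    cases h with
    | inr f => exact ⟨_, .refl, .funApp trivial⟩
    | inl c =>
      choose args' hs hn using fun i => ih i (he i)
      obtain ⟨_, h, hn'⟩ := isBackClosed_isLetNormal.app_of_isLetNormal (P := P) (Sum.inl c)
        -- The lower bounds `⊥` make the approximation conditions void.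
        (fun _ => bot)
        (fun args hct _ => ⟨_, .refl, .cterm ⟨fun i => (hct i).1, fun i => (hct i).2⟩⟩)
        args' hn (fun _ => .bot _)
      exact ⟨_, (LetSteps.app hs).trans h, hn'⟩
  | letE e₁ e₂ ih₁ ih₂ =>
    obtain ⟨e₁', h₁, hn₁⟩ := ih₁ he.1
    obtain ⟨e₂', h₂, hn₂⟩ := ih₂ he.2
    obtain ⟨_, h, hn'⟩ := isBackClosed_isLetNormal.letE_of_isLetNormal (P := P) (s := bot)
      (fun e => IsLetNormal e) (fun h => h.rename _)
      (fun {n e u} h hu _ => ⟨_, .refl, by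
        rw [inst_eq]
        exact h.bindVars (forall_scope_succ.2 ⟨hu, fun X => by
          rw [extSub_shift]
          exact isCTerm_var X⟩)⟩)
      (fun _ _ _ h => ⟨_, .refl, h⟩) hn₁ (.bot _) hn₂
    exact ⟨_, (LetSteps.letE h₁ h₂).trans h, hn'⟩

namespace Expr

/-! ### Free variables -/

/-- Serves the side condition of (Fapp): an expression renamed from `Scope 0` contains no variable
bound by the context. -/
theorem FV_rename_subset {n m : ℕ} (e : Expr S n) (ρ : Scope n → Scope m) :
    (e.rename ρ).FV ⊆ ρ '' e.FV := by
  induction e generalizing m with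
  | var X => exact fun Y hY => ⟨X, rfl, hY.symm⟩
  | bot => exact fun Y hY => hY.elim
  | app h args ih =>
    intro Y hY
    obtain ⟨i, hi⟩ := Set.mem_iUnion.1 hY
    obtain ⟨X, hX, hXY⟩ := ih i ρ hi
    exact ⟨X, Set.mem_iUnion.2 ⟨i, hX⟩, hXY⟩
  | letE e₁ e₂ ih₁ ih₂ =>
    rintro Y (hY | hY)
    · obtain ⟨X, hX, hXY⟩ := ih₁ ρ hY
      exact ⟨X, Or.inl hX, hXY⟩
    · obtain ⟨X, hX, hXY⟩ := ih₂ (liftRen ρ) hY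
      revert X
      refine forall_scope_succ.2 ⟨fun _ h => ?_, fun X hX h => ?_⟩
      · rcases Y with y | j
        · cases h
        · exact (Fin.succ_ne_zero j (Sum.inr_injective h.symm)).elim
      · rw [liftRen_shift] at h
        exact ⟨X, Or.inr hX, Sum.map_injective.2 ⟨Function.injective_id, Fin.succ_injective _⟩ h⟩

theorem FV_finite {n : ℕ} (e : Expr S n) : e.FV.Finite := by
  induction e with
  | var X => exact Set.finite_singleton X
  | bot => exact Set.finite_empty
  | app h args ih => exact Set.finite_iUnion ih
  | letE e₁ e₂ ih₁ ih₂ =>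
    exact ih₁.union (ih₂.preimage
      (Sum.map_injective.2 ⟨Function.injective_id, Fin.succ_injective _⟩).injOn)

theorem one_le_occ {n : ℕ} {e : Expr S n} {x : Var} (h : Sum.inl x ∈ e.FV) : 1 ≤ e.occ x := by
  induction e with
  | var X =>
    cases h
    simp [occ]
  | bot => exact h.elim
  | app f args ih =>
    obtain ⟨i, hi⟩ := Set.mem_iUnion.1 h
    exact (ih i hi).trans
      (Finset.single_le_sum (f := fun i => (args i).occ x) (fun _ _ => Nat.zero_le _)
        (Finset.mem_univ i))
  | letE e₁ e₂ ih₁ ih₂ =>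
    rcases h with h | h
    · exact (ih₁ h).trans (Nat.le_add_right _ _)
    · exact (ih₂ h).trans (Nat.le_add_left _ _)

/-! ### Matching -/

theorem subst_congr {m : ℕ} (e : Expr S 0) {θ θ' : Var → Expr S m}
    (h : ∀ x, Sum.inl x ∈ e.FV → θ x = θ' x) : e.subst θ = e.subst θ' :=
  bindVars_congr e fun X hX => match X, hX with
    | Sum.inl x, hx => h x hx
    | Sum.inr i, _ => i.elim0

/-- The matching substitutions of the members of a linear tuple have a common value. -/
theorem exists_subst_of_linear {ι : Type*} [Fintype ι] {m : ℕ} (ps : ι → Expr S 0)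
    (hlin : ∀ x, ∑ i, (ps i).occ x ≤ 1) (us : ι → Expr S m) (R : Var → Expr S m → Prop)
    (h : ∀ i, ∃ θ : Var → Expr S m, us i = (ps i).subst θ ∧
      ∀ x, Sum.inl x ∈ (ps i).FV → R x (θ x)) :
    ∃ θ : Var → Expr S m, (∀ i, us i = (ps i).subst θ) ∧
      ∀ i x, Sum.inl x ∈ (ps i).FV → R x (θ x) := by
  classical
  choose θ hθ hR using h
  have huniq : ∀ {x i j}, Sum.inl x ∈ (ps i).FV → Sum.inl x ∈ (ps j).FV → i = j := by
    intro x i j hi hj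
    by_contra hij
    -- Two different members containing `x` would contribute at least 2 to the count of occurrences.
    have h2 := Finset.sum_le_sum_of_subset (f := fun i => (ps i).occ x)
      (Finset.subset_univ {i, j})
    rw [Finset.sum_pair hij] at h2
    have := one_le_occ hi
    have := one_le_occ hj
    have := hlin x
    omega
  let θ' : Var → Expr S m := fun x =>
    if hx : ∃ i, Sum.inl x ∈ (ps i).FV then θ hx.choose x else var (Sum.inl x)
  have hθ' : ∀ i x, Sum.inl x ∈ (ps i).FV → θ' x = θ i x := by
    intro i x hx
    have hex : ∃ i, Sum.inl x ∈ (ps i).FV := ⟨i, hx⟩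
    rw [show θ' x = θ hex.choose x from dif_pos hex, huniq hex.choose_spec hx]
  refine ⟨θ', fun i => ?_, fun i x hx => ?_⟩
  · rw [hθ i]
    exact subst_congr _ fun x hx => (hθ' i x hx).symm
  · rw [hθ' i x hx]
    exact hR i x hx

/-- A linear c-term matches each c-term whose value is above an instance of it. -/
theorem exists_subst_of_approx_close {m : ℕ} {p : Expr S 0} (hp : p.IsCTerm)
    (hlin : ∀ x, p.occ x ≤ 1) {u : Expr S m} (hu : u.IsCTerm) {θ : Var → Expr S 0}
    (h : Approx (p.subst θ) u.close) :
    ∃ θ' : Var → Expr S m, u = p.subst θ' ∧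
      ∀ x, Sum.inl x ∈ p.FV → (θ' x).IsCTerm ∧ Approx (θ x) (θ' x).close := by
  suffices H : ∀ {k : ℕ} (p : Expr S k) (hk : k = 0) (u : Expr S m), p.IsCTerm →
      (∀ x, p.occ x ≤ 1) → u.IsCTerm → Approx ((hk ▸ p : Expr S 0).subst θ) u.close →
      ∃ θ' : Var → Expr S m, u = (hk ▸ p : Expr S 0).subst θ' ∧
        ∀ x, Sum.inl x ∈ (hk ▸ p : Expr S 0).FV →
          (θ' x).IsCTerm ∧ Approx (θ x) (θ' x).close from H p rfl u hp hlin hu h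
  intro k p
  induction p with
  | var X =>
    rintro rfl u - - hu h
    rcases X with x | i
    · refine ⟨fun _ => u, rfl, fun y hy => ?_⟩
      cases hy
      exact ⟨hu, h⟩
    · exact i.elim0
  | bot =>
    rintro rfl u hp
    exact hp.2.elim
  | app f ps ih =>
    rintro rfl u hp hlin hu h
    cases f with
    | inr f => exact hp.1.elim
    | inl c =>
      cases u with
      -- A free variable closes to itself and a bound one to `⊥`; neither is above `c(…)`.
      | var X => rcases X with x | i <;> cases h
      | bot => exact hu.2.elim
      | letE => exact hu.1.elim
      | app f us =>
        cases h with
        | app _ _ _ h =>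
          obtain ⟨θ', h1, h2⟩ := exists_subst_of_linear ps hlin us
            (fun x v => v.IsCTerm ∧ Approx (θ x) v.close)
            (fun i => ih i rfl (us i) ⟨hp.1 i, hp.2 i⟩
              (fun x => (Finset.single_le_sum (f := fun i => (ps i).occ x)
                (fun _ _ => Nat.zero_le _) (Finset.mem_univ i)).trans (hlin x))
              ⟨hu.1 i, hu.2 i⟩ (h i))
          refine ⟨θ', congrArg (app (Sum.inl c)) (funext h1), fun x hx => ?_⟩
          obtain ⟨i, hi⟩ := Set.mem_iUnion.1 hx
          exact h2 i x hi
  | letE e₁ e₂ ih₁ ih₂ =>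
    intro _ u hp
    exact hp.1.elim

/-- Each `⊥` is replaced by an arbitrary free variable. This makes the values of extra variables in
(OR) admissible for (Fapp). -/
theorem IsPartialCTerm.exists_isCTerm {n : ℕ} {e : Expr S n} (he : e.IsPartialCTerm) :
    ∃ e' : Expr S n, e'.IsCTerm ∧ Approx e e' := by
  induction e with
  | var X => exact ⟨_, isCTerm_var X, .refl _⟩
  | bot => exact ⟨_, isCTerm_var (Sum.inl 0), .bot _⟩
  | app h args ih =>
    cases h with
    | inl c =>
      choose e' h1 h2 using fun i => ih i (he i)
      exact ⟨app (Sum.inl c) e', ⟨fun i => (h1 i).1, fun i => (h1 i).2⟩, .app _ _ _ h2⟩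
    | inr f => exact he.elim
  | letE e₁ e₂ ih₁ ih₂ => exact he.elim

theorem close_subst_approx {m : ℕ} (e : Expr S 0) {θ : Var → Expr S 0} {θ' : Var → Expr S m}
    (h : ∀ x, Approx (θ x) (θ' x).close) : Approx (e.subst θ) (e.subst θ').close := by
  rw [close, subst, subst, bindVars_bindVars]
  exact (Approx.refl e).bindVars fun X => match X with
    | Sum.inl x => h x
    | Sum.inr i => i.elim0

theorem close_eq_self (e : Expr S 0) : e.close = e := by
  rw [close]
  refine Eq.trans ?_ (bindVars_var e)
  congr 1
  funext X
  rcases X with x | i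
  · rfl
  · exact i.elim0

/-- An expression below one let-binder, in which the other variables that are bound from outside
stand for `⊥`. -/
def closeBody {n : ℕ} (e : Expr S (n + 1)) : Expr S 1 :=
  e.bindVars (liftSub (Sum.elim (fun x => var (Sum.inl x)) fun _ => bot))

/-- This is the reading of a let resolved by (Bind); `closeBody_inst_bot` is that of a let that is
kept. -/
theorem closeBody_inst_close {n : ℕ} (e : Expr S (n + 1)) (u : Expr S n) :
    e.closeBody.inst u.close = (e.inst u).close := by
  rw [closeBody, bindVars_liftSub_inst, close, close, inst_bindVars]

theorem closeBody_inst_bot {n : ℕ} (e : Expr S (n + 1)) : e.closeBody.inst bot = e.close := by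
  rw [closeBody, bindVars_liftSub_inst, close]
  congr 1
  exact funext_scope_succ rfl fun X => by cases X <;> rfl

theorem closeBody_rename {n : ℕ} (e : Expr S (n + 1)) :
    (e.rename (liftRen Scope.shift)).closeBody = e.closeBody := by
  rw [closeBody, bindVars_rename, closeBody]
  congr 1
  exact funext_scope_succ rfl fun X => by cases X <;> rfl

end Expr

/-- A rule can be applied where the arguments match its left-hand side up to approximation. -/
theorem exists_letStep_of_approx {R : Rule S} (hR : R ∈ P) {θ : Var → Expr S 0}
    (hθ : IsPartialCSubst θ) {n : ℕ} {us : Fin (S.arity (Sum.inr R.f)) → Expr S n}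
    (hus : ∀ i, (us i).IsCTerm) (h : ∀ i, Approx ((R.lhs i).subst θ) (us i).close) :
    ∃ θ' : Var → Expr S n, (∀ x, Approx (θ x) (θ' x).close) ∧
      LetStep P (app (Sum.inr R.f) us) (R.rhs.subst θ') := by
  classical
  obtain ⟨θ₁, h₁, h₁'⟩ := exists_subst_of_linear R.lhs R.lhs_linear us
    (fun x w => w.IsCTerm ∧ Approx (θ x) w.close) fun i =>
      exists_subst_of_approx_close (R.lhs_cterm i)
        (fun x => (Finset.single_le_sum (f := fun i => (R.lhs i).occ x)
          (fun _ _ => Nat.zero_le _) (Finset.mem_univ i)).trans (R.lhs_linear x)) (hus i) (h i)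
  choose θ₂ h₂ h₂' using fun x => (hθ.2 x).exists_isCTerm
  let ι : Scope 0 → Scope n := Sum.map id Fin.elim0
  -- Matching determines the variables of the left-hand side; extra variables get total values above
  -- those of `θ`, coming from the scope without bound variables.
  let θ' : Var → Expr S n := fun x => if x ∈ R.lhsVars then θ₁ x else (θ₂ x).rename ι
  have hin : ∀ {x}, x ∈ R.lhsVars → θ' x = θ₁ x := fun hx => if_pos hx
  have hout : ∀ {x}, x ∉ R.lhsVars → θ' x = (θ₂ x).rename ι := fun hx => if_neg hx
  have hfin : R.lhsVars.Finite := by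
    have : R.lhsVars = ⋃ i, Sum.inl ⁻¹' (R.lhs i).FV := by
      ext x
      simp [Rule.lhsVars]
    rw [this]
    exact Set.finite_iUnion fun i => (FV_finite _).preimage Sum.inl_injective.injOn
  refine ⟨θ', fun x => ?_, ?_⟩
  · by_cases hx : x ∈ R.lhsVars
    · rw [hin hx]
      obtain ⟨i, hi⟩ := hx
      exact (h₁' i x hi).2
    · rw [hout hx]
      refine (h₂' x).trans (.of_eq ?_)
      rw [close, bindVars_rename]
      refine (close_eq_self _).symm.trans ?_
      rw [close]
      congr 1
      funext X
      rcases X with x | i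
      · rfl
      · exact i.elim0
  · have hus' : us = fun i => (R.lhs i).subst θ' := funext fun i => by
      rw [h₁ i]
      exact subst_congr _ fun x hx => (hin ⟨i, hx⟩).symm
    rw [hus']
    refine .fapp R θ' hR ⟨(hfin.union hθ.1).subset fun x hx => ?_, fun x => ?_⟩ fun x hx j hj => ?_
    -- Outside the domain of `θ` the value `x` is already total, so `θ₂` cannot enlarge it.
    · by_contra hx'
      rw [Set.mem_union, not_or] at hx'
      have hθx : θ x = var (Sum.inl x) := not_not.1 hx'.2
      have h₂x := h₂' x
      rw [hθx] at h₂x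
      refine hx ?_
      rw [hout hx'.1, ← h₂x.eq_of_isTotal trivial]
      rfl
    · by_cases hx : x ∈ R.lhsVars
      · rw [hin hx]
        obtain ⟨i, hi⟩ := hx
        exact (h₁' i x hi).1
      · rw [hout hx]
        exact (h₂ x).rename _
    · rw [hout hx] at hj
      obtain ⟨X, -, hX⟩ := FV_rename_subset _ _ hj
      rcases X with x | i
      · cases hX
      · exact i.elim0

/-! ### Completeness -/

theorem isBackClosed_approx_shell (t : Expr S 0) :
    IsBackClosed P fun {_} e => ∃ e', LetSteps P e e' ∧ Approx t e'.shell.close where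
  step hs := fun ⟨e', h, ht⟩ => ⟨e', h.head hs, ht⟩
  letE ha := fun ⟨_, h, ht⟩ => ⟨_, LetSteps.letE .refl h, (close_shell_letE ha).symm ▸ ht⟩

/-- Apart from `bot`, the root of `e` forces that of `a`, as `close` only turns bound variables into
`⊥`. Arbitrary scopes and `⊑` are needed because the induction hypotheses are used below floated
lets and with larger, total instances. -/
theorem CRWLlet.exists_letSteps {e t : Expr S 0} (h : CRWLlet P e t) :
    ∀ {n : ℕ} {a : Expr S n}, a.IsTotal → Approx e a.close →
      ∃ a', LetSteps P a a' ∧ Approx t a'.shell.close := by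
  have hnorm : ∀ {t : Expr S 0} {n : ℕ} {a : Expr S n}, a.IsTotal →
      (∃ a', LetSteps P a a' ∧ Approx t a'.shell.close) →
      ∃ a', LetSteps P a a' ∧ IsLetNormal a' ∧ Approx t a'.shell.close := by
    rintro t n a ha ⟨a₁, h₁, ht⟩
    obtain ⟨a₂, h₂, hn⟩ := exists_isLetNormal (P := P) (h₁.isTotal ha)
    exact ⟨a₂, h₁.trans h₂, hn, ht.trans (h₂.shell_approx.bindVars fun _ => .refl _)⟩
  induction h with
  | B e => exact fun _ _ => ⟨_, .refl, .bot _⟩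
  | RR x =>
    intro n a ha hea
    cases a with
    | var X => exact ⟨_, .refl, hea⟩
    | bot => exact ha.elim
    | app => cases hea
    | letE => cases hea
  | DC c es ts _ ih =>
    intro n a ha hea
    cases a with
    | var X => rcases X with x | i <;> cases hea
    | bot => exact ha.elim
    | letE => cases hea
    | app f as =>
      cases hea with
      | app _ _ _ hea =>
        choose as' h₁ h₂ using fun i => ih i (ha i) (hea i)
        exact ⟨app (Sum.inl c) as', .app h₁, .app _ _ _ h₂⟩
  | OR R θ es t hR hθ _ _ ih₁ ih₂ =>
    intro n a ha hea
    cases a with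
    | var X => rcases X with x | i <;> cases hea
    | bot => exact ha.elim
    | letE => cases hea
    | app f as =>
      cases hea with
      | app _ _ _ hea =>
        choose as' h₁ hn h₂ using fun i => hnorm (ha i) (ih₁ i (ha i) (hea i))
        suffices H : ∀ {m : ℕ} (us : Fin (S.arity (Sum.inr R.f)) → Expr S m),
            (∀ i, (us i).IsCTerm) → (∀ i, Approx ((R.lhs i).subst θ) (us i).close) →
            ∃ a', LetSteps P (app (Sum.inr R.f) us) a' ∧ Approx t a'.shell.close by
          obtain ⟨a', h, ht⟩ := (isBackClosed_approx_shell (P := P) t).app_of_isLetNormal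
            (Sum.inr R.f) _ H as' hn h₂
          exact ⟨a', (LetSteps.app h₁).trans h, ht⟩
        intro m us hus hlhs
        obtain ⟨θ', hθ', hs⟩ := exists_letStep_of_approx hR hθ hus hlhs
        -- The instance of the right-hand side by `θ'` closes to something above the one by `θ`.
        obtain ⟨a', h, ht⟩ := ih₂ (hs.isTotal fun i => (hus i).2) (close_subst_approx _ hθ')
        exact ⟨a', h.head hs, ht⟩
  | Let e₁ e₂ t₁ t _ _ ih₁ ih₂ =>
    intro n a ha hea
    cases a with
    | var X => rcases X with x | i <;> cases hea
    | bot => exact ha.elim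
    | app => cases hea
    | letE a₁ a₂ =>
      cases hea with
      | letE _ _ _ _ hea₁ hea₂ =>
        obtain ⟨a₁', h₁, hn, ht₁⟩ := hnorm ha.1 (ih₁ ha.1 hea₁)
        obtain ⟨a', h, ht⟩ := (isBackClosed_approx_shell (P := P) t).letE_of_isLetNormal
          (s := t₁) (fun b => b.IsTotal ∧ Approx e₂ b.closeBody)
          (fun h => ⟨h.1.rename _, (closeBody_rename _).symm ▸ h.2⟩)
          (fun {_ b w} h hw hs => ih₂ (h.1.inst hw.2)
            ((h.2.inst hs).trans (.of_eq (closeBody_inst_close b w))))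
          -- The let is kept and `t₁ = ⊥`, so `e₂.inst t₁` is approximated by the body with its
          -- variable read as `⊥`.
          (fun hbot {_ b} h => ih₂ h.1 (by
            rw [hbot, ← closeBody_inst_bot]
            exact h.2.inst (.refl _)))
          hn ht₁ ⟨ha.2, hea₂⟩
        exact ⟨a', (LetSteps.letE h₁ .refl).trans h, ht⟩

theorem CRWL.toCRWLlet {e t : Expr S 0} (h : CRWL P e t) : CRWLlet P e t := by
  induction h with
  | B e _ => exact .B e
  | RR x => exact .RR x
  | DC c es ts _ ih => exact .DC c es ts ih
  | OR R θ es t hR hθ _ _ ih₁ ih₂ => exact .OR R θ es t hR hθ ih₁ ih₂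

theorem CRWLlet.exists_letRewrites {e t : Expr S 0} (he : e.IsTotal) (h : CRWLlet P e t) :
    ∃ e' : Expr S 0, e'.IsTotal ∧ LetRewrites P e e' ∧ t.Approx e'.shell := by
  obtain ⟨e', h', ht⟩ := h.exists_letSteps he (.of_eq (close_eq_self e).symm)
  rw [close_eq_self] at ht
  exact ⟨e', LetSteps.isTotal h' he, h', ht⟩

theorem CRWLlet.letRewrites {e t : Expr S 0} (he : e.IsTotal) (ht : t.IsCTerm)
    (h : CRWLlet P e t) : LetRewrites P e t := by
  obtain ⟨e', -, h', ht'⟩ := h.exists_letRewrites he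
  obtain rfl := ht'.eq_of_isTotal ht.2
  exact h'.trans (letSteps_shell ht.2)

end LetRewriting

theorem mainTheorem3 (S : LetRewriting.Signature.{u, v}) (P : LetRewriting.Program S)
    (e : LetRewriting.Expr S 0) (he : e.IsTotal)
    (t : LetRewriting.Expr S 0) (ht : t.IsPartialCTerm) :
    (LetRewriting.CRWLlet P e t →
      ∃ e' : LetRewriting.Expr S 0,
        e'.IsTotal ∧ LetRewriting.LetRewrites P e e' ∧ t.Approx e'.shell) ∧
    (t.IsCTerm → LetRewriting.CRWLlet P e t → LetRewriting.LetRewrites P e t) ∧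
    (P.LetFree → e.LetFree →
      (LetRewriting.CRWL P e t →
        ∃ e' : LetRewriting.Expr S 0,
          e'.IsTotal ∧ LetRewriting.LetRewrites P e e' ∧ t.Approx e'.shell) ∧
      (t.IsCTerm → LetRewriting.CRWL P e t → LetRewriting.LetRewrites P e t)) :=
  ⟨fun h => h.exists_letRewrites he, fun hc h => h.letRewrites he hc, fun _ _ =>
    ⟨fun h => h.toCRWLlet.exists_letRewrites he, fun hc h => h.toCRWLlet.letRewrites he hc⟩⟩
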